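/- Let $f\colon\{0,1\}^n\to\{0,1\}$ be a Boolean function. For $x\in\{0,1\}^n$ and $R\subseteq\{1,\dots,n\}$ let $x^{(R)}$ be $x$ with the bits in $R$ flipped. The block sensitivity $bs(f)$ is the maximum over $x$ of the largest number $t$ of pairwise disjoint sets $R_1,\dots,R_t\subseteq\{1,\dots,n\}$ with $f(x)\neq f(x^{(R_j)})$ for all $j$; the sensitivity $s(f)$ is the maximum over $x$ of the number of $i$ with $f(x)\neq f(x^{(\{i\})})$. If $f$ is not a single variable $x_i$ or its negation $1-x_i$, then $$s(f)^4\ \ge\ (\sqrt{10}-2)\,bs(f).$$ -/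

import Mathlib

namespace BooleanFunction

/-- The input `x^(R)`: the bits of `x` whose index lies in the block `R` are flipped. -/
def flipBlock {n : ℕ} (x : Fin n → Bool) (R : Finset (Fin n)) : Fin n → Bool :=
  fun i => if i ∈ R then !(x i) else x i

/-- A family `𝓡` of pairwise disjoint blocks, each of which changes the value of `f` at `x` when
flipped. (Such blocks are automatically nonempty, so a set of disjoint blocks is the same as a list
of disjoint blocks `R₁, …, R_t`, with `t` the number of elements.) -/
def IsSensitiveFamily {n : ℕ} (f : (Fin n → Bool) → Bool) (x : Fin n → Bool)
    (𝓡 : Finset (Finset (Fin n))) : Prop :=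
  (∀ R ∈ 𝓡, ∀ S ∈ 𝓡, R ≠ S → Disjoint R S) ∧ ∀ R ∈ 𝓡, f x ≠ f (flipBlock x R)

instance {n : ℕ} (f : (Fin n → Bool) → Bool) (x : Fin n → Bool) :
    DecidablePred (IsSensitiveFamily f x) := fun 𝓡 => by
  unfold IsSensitiveFamily
  infer_instance

/-- Local block sensitivity `bs(f, x)`: the largest size of a family of pairwise disjoint blocks
each of which changes the value of `f` at `x`. -/
def localBlockSensitivity {n : ℕ} (f : (Fin n → Bool) → Bool) (x : Fin n → Bool) : ℕ :=
  (Finset.univ.filter fun 𝓡 : Finset (Finset (Fin n)) => IsSensitiveFamily f x 𝓡).sup Finset.card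

/-- Block sensitivity `bs(f)`: the maximum of `bs(f, x)` over all inputs `x`. -/
def blockSensitivity {n : ℕ} (f : (Fin n → Bool) → Bool) : ℕ :=
  Finset.univ.sup (localBlockSensitivity f)

/-- Local sensitivity `s(f, x)`: the number of coordinates `i` such that flipping the `i`-th bit
of `x` changes the value of `f`, that is, the largest number of disjoint blocks of size `1` each of
which changes the value of `f` at `x`. -/
def localSensitivity {n : ℕ} (f : (Fin n → Bool) → Bool) (x : Fin n → Bool) : ℕ :=
  (Finset.univ.filter fun i : Fin n => f x ≠ f (flipBlock x {i})).card

/-- Sensitivity `s(f)`: the maximum of `s(f, x)` over all inputs `x`. -/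
def sensitivity {n : ℕ} (f : (Fin n → Bool) → Bool) : ℕ :=
  Finset.univ.sup (localSensitivity f)

/-- `f` is a literal: a single variable `x_i` or its negation. -/
def IsLiteral {n : ℕ} (f : (Fin n → Bool) → Bool) : Prop :=
  ∃ i : Fin n, (∀ x, f x = x i) ∨ (∀ x, f x = !(x i))

end BooleanFunction

/-! At an input with b = bs(f) disjoint sensitive blocks, flip each block independently with
probability t, and let p(t) be the probability that the value changes. This polynomial maps [0, 1]
into [0, 1]. Its degree is at most s(f)^2, by Huang's theorem and the Gotsman–Linial reduction
(`card_le_sq_of_coefficient_ne_zero`). Flipping nothing never changes the value and flipping a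
single block always does, so the t^2 coefficient of p is at most -b(b-1)/2
(`coeff_two_blockPolynomial_le`). V. A. Markov's inequality bounds how negative it can be
(`neg_coeff_two_le`). With N = s(f)^4 this reads b(b-1)/2 ≤ N(N-1)/3, which suffices once s(f) ≥ 2.
If s(f) ≤ 1, then f is constant or a literal. -/

namespace BooleanFunction

open Finset symmDiff

section Parity

variable {β : Type*}

/-- Multiplication by the parity of the vertex. -/
def parityTwist : (Finset β → ℝ) →ₗ[ℝ] (Finset β → ℝ) where
  toFun φ X := (-1) ^ #X * φ X
  map_add' φ ψ := by
    ext X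
    simp [mul_add]
  map_smul' r φ := by
    ext X
    simp [mul_left_comm]

lemma neg_one_pow_card_symmDiff_singleton [DecidableEq β] (X : Finset β) (i : β) :
    (-1 : ℝ) ^ #(X ∆ {i}) = -(-1) ^ #X := by
  by_cases h : i ∈ X
  · have h₁ : X ∆ {i} = X.erase i := by
      ext j
      by_cases hj : j = i <;> simp [mem_symmDiff, hj, h]
    rw [h₁, ← card_erase_add_one h, pow_succ]
    ring
  · have h₁ : X ∆ {i} = insert i X := by
      ext j
      by_cases hj : j = i <;> simp [mem_symmDiff, hj, h]
    rw [h₁, card_insert_of_notMem h, pow_succ]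
    ring

lemma parityTwist_parityTwist (φ : Finset β → ℝ) : parityTwist (parityTwist φ) = φ := by
  ext X
  simp [parityTwist, ← mul_assoc, ← mul_pow]

end Parity

/-! ### Huang's theorem and the Gotsman–Linial reduction -/

section Hypercube

variable {β : Type*} [Fintype β] [LinearOrder β]

/-- The sign of the edge in direction `i` at the vertex `X` in Huang's signing of the hypercube. -/
def edgeSign (i : β) (X : Finset β) : ℝ :=
  ∏ j, if j ∈ X ∧ j < i then -1 else 1

lemma edgeSign_symmDiff_singleton (i k : β) (X : Finset β) :
    edgeSign i (X ∆ {k}) = (if k < i then -1 else 1) * edgeSign i X := by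
  have h : (if k < i then (-1 : ℝ) else 1) =
      ∏ j, if j = k then (if k < i then (-1 : ℝ) else 1) else 1 := by
    simp
  rw [h, edgeSign, edgeSign, ← prod_mul_distrib]
  refine prod_congr rfl fun j _ => ?_
  by_cases hjk : j = k
  · subst hjk
    by_cases hj : j ∈ X <;> by_cases hji : j < i <;> simp [mem_symmDiff, hj, hji]
  · simp [mem_symmDiff, hjk]

lemma abs_edgeSign (i : β) (X : Finset β) : |edgeSign i X| = 1 := by
  rw [edgeSign, abs_prod]
  refine prod_eq_one fun j _ => ?_
  split_ifs <;> simp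

lemma edgeSign_mul_self (i : β) (X : Finset β) : edgeSign i X * edgeSign i X = 1 := by
  rw [← abs_mul_abs_self, abs_edgeSign, one_mul]

/-- Huang's signed adjacency operator of the hypercube. -/
def signedAdjacency : (Finset β → ℝ) →ₗ[ℝ] (Finset β → ℝ) where
  toFun φ X := ∑ i, edgeSign i X * φ (X ∆ {i})
  map_add' φ ψ := by
    ext X
    simp [mul_add, sum_add_distrib]
  map_smul' r φ := by
    ext X
    simp [mul_sum, mul_left_comm]

lemma signedAdjacency_apply (φ : Finset β → ℝ) (X : Finset β) :
    signedAdjacency φ X = ∑ i, edgeSign i X * φ (X ∆ {i}) := rfl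

/-- The signs around every square of the cube multiply to -1, so the two paths between opposite
corners cancel and only the returns to the start survive. -/
lemma signedAdjacency_signedAdjacency (φ : Finset β → ℝ) :
    signedAdjacency (signedAdjacency φ) = (Fintype.card β : ℝ) • φ := by
  ext X
  set g : β → β → ℝ := fun i j =>
    edgeSign i X * (edgeSign j (X ∆ {i}) * φ (X ∆ {i} ∆ {j})) with hg
  have hsum : signedAdjacency (signedAdjacency φ) X = ∑ i, ∑ j, g i j := by
    simp only [signedAdjacency_apply, mul_sum, hg]
  -- For i ≠ j, exactly one of the two orders of flipping picks up an extra sign.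
  have hpair (i j : β) : g i j + g j i = if i = j then 2 * φ X else 0 := by
    simp only [hg, edgeSign_symmDiff_singleton]
    rcases lt_trichotomy i j with h | rfl | h
    · rw [symmDiff_right_comm X {j} {i}]
      simp only [h, h.not_gt, h.ne, if_true, if_false]
      ring
    · rw [symmDiff_symmDiff_cancel_right]
      simp only [lt_irrefl, if_true, if_false]
      linear_combination 2 * φ X * edgeSign_mul_self i X
    · rw [symmDiff_right_comm X {j} {i}]
      simp only [h, h.not_gt, h.ne', if_true, if_false]
      ring
  have htwo : 2 * ∑ i, ∑ j, g i j = 2 * (Fintype.card β * φ X) := by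
    calc 2 * ∑ i, ∑ j, g i j = ∑ i, ∑ j, g i j + ∑ i, ∑ j, g j i := by
          rw [two_mul]
          congr 1
          exact sum_comm
      _ = ∑ i, ∑ j, (g i j + g j i) := by simp only [sum_add_distrib]
      _ = 2 * (Fintype.card β * φ X) := by
          simp only [hpair, sum_ite_eq, mem_univ, if_true, sum_const, card_univ, nsmul_eq_mul]
          ring
  rw [hsum, Pi.smul_apply, smul_eq_mul]
  linarith

lemma signedAdjacency_parityTwist (φ : Finset β → ℝ) :
    signedAdjacency (parityTwist φ) = -parityTwist (signedAdjacency φ) := by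
  ext X
  simp only [signedAdjacency_apply, parityTwist, LinearMap.coe_mk, AddHom.coe_mk, Pi.neg_apply,
    neg_one_pow_card_symmDiff_singleton, mul_sum, ← sum_neg_distrib]
  exact sum_congr rfl fun i _ => by ring

/-- A dimension count without computing eigenspaces. As A² = r², A - r maps into the
(-r)-eigenspace, and the parity twist carries that into the r-eigenspace. Two copies of the
functions on `𝒮` have total dimension over 2^N, so some nonzero pair has images summing to 0. The
eigenspaces are independent, hence both images vanish. -/
lemma exists_eigenvector_supported (h₀ : 0 < Fintype.card β) (𝒮 : Finset (Finset β))
    (h𝒮 : 2 ^ Fintype.card β < 2 * #𝒮) :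
    ∃ φ : Finset β → ℝ, φ ≠ 0 ∧ (∀ X ∉ 𝒮, φ X = 0) ∧
      signedAdjacency φ = √(Fintype.card β) • φ := by
  set r : ℝ := √(Fintype.card β) with hr
  have hr₀ : 0 < r := Real.sqrt_pos.2 (by exact_mod_cast h₀)
  have hrr : r * r = Fintype.card β := Real.mul_self_sqrt (by positivity)
  set E : (𝒮 → ℝ) →ₗ[ℝ] (Finset β → ℝ) :=
    Function.ExtendByZero.linearMap ℝ (Subtype.val : 𝒮 → Finset β) with hE
  have hEinj : Function.Injective E := by
    intro u v huv
    ext X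
    have := congrFun huv X.1
    simpa [hE, Subtype.val_injective.extend_apply] using this
  set K : (𝒮 → ℝ) →ₗ[ℝ] (Finset β → ℝ) := (signedAdjacency - r • LinearMap.id) ∘ₗ E with hK
  have hKapp (u : 𝒮 → ℝ) : K u = signedAdjacency (E u) - r • E u := rfl
  have hKneg (u : 𝒮 → ℝ) : signedAdjacency (K u) = -(r • K u) := by
    rw [hKapp, map_sub, map_smul, signedAdjacency_signedAdjacency, ← hrr, smul_sub, smul_smul]
    abel
  have hker : LinearMap.ker (K.coprod (parityTwist ∘ₗ K)) ≠ ⊥ := by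
    apply LinearMap.ker_ne_bot_of_finrank_lt
    simp only [Module.finrank_prod, Module.finrank_fintype_fun_eq_card, Fintype.card_finset,
      Fintype.card_coe]
    omega
  obtain ⟨⟨u, v⟩, huv, hne⟩ := (Submodule.ne_bot_iff _).1 hker
  have hsum : K u + parityTwist (K v) = 0 := by simpa using huv
  have hpos : signedAdjacency (parityTwist (K v)) = r • parityTwist (K v) := by
    rw [signedAdjacency_parityTwist, hKneg, map_neg, map_smul, neg_neg]
  have hu : K u = 0 := by
    have h₁ : parityTwist (K v) = -K u := (neg_eq_of_add_eq_zero_right hsum).symm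
    rw [h₁, map_neg, hKneg, neg_neg, smul_neg] at hpos
    have h₂ : (2 * r) • K u = 0 := by
      rw [two_mul, add_smul]
      nth_rw 1 [hpos]
      exact neg_add_cancel _
    exact (smul_eq_zero.1 h₂).resolve_left (by positivity)
  have hv : K v = 0 := by
    rw [hu, zero_add] at hsum
    rw [← parityTwist_parityTwist (K v), hsum, map_zero]
  obtain ⟨w, hw, hKw⟩ : ∃ w, w ≠ 0 ∧ K w = 0 := by
    by_cases h : u = 0
    · exact ⟨v, fun h' => hne (by simp [h, h']), hv⟩
    · exact ⟨u, h, hu⟩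
  refine ⟨E w, fun h => hw (hEinj (by rw [h, map_zero])), fun X hX => ?_, sub_eq_zero.1 hKw⟩
  rw [hE, Function.ExtendByZero.linearMap_apply, Function.extend_apply']
  · rfl
  · rintro ⟨Y, rfl⟩
    exact hX Y.2

/-- **Huang's theorem**: more than half of the vertices of a hypercube of dimension `N` induce a
subgraph with a vertex of degree at least `√N`. -/
theorem exists_card_le_degree_sq (𝒮 : Finset (Finset β)) (h𝒮 : 2 ^ Fintype.card β < 2 * #𝒮) :
    ∃ X ∈ 𝒮, Fintype.card β ≤ #{i | X ∆ {i} ∈ 𝒮} ^ 2 := by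
  rcases Nat.eq_zero_or_pos (Fintype.card β) with h₀ | h₀
  · obtain ⟨X, hX⟩ : 𝒮.Nonempty := by
      rw [← card_pos]
      have := Nat.two_pow_pos (Fintype.card β)
      omega
    exact ⟨X, hX, by simp [h₀]⟩
  obtain ⟨φ, hne, hsupp, heig⟩ := exists_eigenvector_supported h₀ 𝒮 h𝒮
  -- Read the eigenvalue equation at a vertex where |φ| is largest.
  obtain ⟨X, -, hmax⟩ := exists_max_image univ (fun X => |φ X|) univ_nonempty
  have hpos : 0 < |φ X| := by
    obtain ⟨Y, hY⟩ := Function.ne_iff.1 hne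
    exact (abs_pos.2 hY).trans_le (hmax Y (mem_univ _))
  have hX : X ∈ 𝒮 := by
    by_contra h
    simp [hsupp X h] at hpos
  refine ⟨X, hX, ?_⟩
  have hle : √(Fintype.card β) * |φ X| ≤ #{i | X ∆ {i} ∈ 𝒮} * |φ X| := by
    calc √(Fintype.card β) * |φ X| = |signedAdjacency φ X| := by
          rw [heig, Pi.smul_apply, smul_eq_mul, abs_mul, abs_of_nonneg (Real.sqrt_nonneg _)]
      _ ≤ ∑ i, |edgeSign i X * φ (X ∆ {i})| := abs_sum_le_sum_abs _ _
      _ = ∑ i, |φ (X ∆ {i})| := by simp only [abs_mul, abs_edgeSign, one_mul]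
      _ ≤ ∑ i, if X ∆ {i} ∈ 𝒮 then |φ X| else 0 := by
          refine sum_le_sum fun i _ => ?_
          split_ifs with h
          · exact hmax _ (mem_univ _)
          · simp [hsupp _ h]
      _ = #{i | X ∆ {i} ∈ 𝒮} * |φ X| := by
          rw [← sum_filter, sum_const, nsmul_eq_mul]
  have := (Real.sqrt_le_left (by positivity)).1 (le_of_mul_le_mul_right hle hpos)
  exact_mod_cast this

/-- A Boolean function on a hypercube of dimension `N` that correlates with the parity function has
a vertex of sensitivity at least `√N`. -/
theorem exists_card_le_sensitivity_sq (F : Finset β → Bool)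
    (hF : ∑ X, (-1 : ℝ) ^ #X * (if F X then 1 else 0) ≠ 0) :
    ∃ X, Fintype.card β ≤ #{i | F X ≠ F (X ∆ {i})} ^ 2 := by
  rcases Nat.eq_zero_or_pos (Fintype.card β) with h₀ | h₀
  · exact ⟨∅, by simp [h₀]⟩
  have key (ε : ℝ) (hε : ε = 1 ∨ ε = -1) (𝒮 : Finset (Finset β))
      (h𝒮 : ∀ X, X ∈ 𝒮 ↔ (-1 : ℝ) ^ #X = if F X then ε else -ε)
      (h : 2 ^ Fintype.card β < 2 * #𝒮) :
      ∃ X, Fintype.card β ≤ #{i | F X ≠ F (X ∆ {i})} ^ 2 := by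
    obtain ⟨X, hX, hle⟩ := exists_card_le_degree_sq _ h
    refine ⟨X, hle.trans (Nat.pow_le_pow_left (card_le_card fun i hi => ?_) 2)⟩
    simp only [mem_filter, mem_univ, true_and, h𝒮] at hX hi ⊢
    intro hFX
    rw [neg_one_pow_card_symmDiff_singleton, hX, ← hFX] at hi
    rcases hε with rfl | rfl <;> split_ifs at hi <;> norm_num at hi
  by_contra hcon
  -- Parity changes along every edge, so `F` changes along each edge inside `𝒜` or inside its
  -- complement. Nonzero correlation means that one of the two is more than half of the cube.
  set 𝒜 : Finset (Finset β) := {X | (-1 : ℝ) ^ #X = if F X then 1 else -1} with h𝒜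
  have hmem (X : Finset β) : X ∈ 𝒜 ↔ (-1 : ℝ) ^ #X = if F X then 1 else -1 := by simp [h𝒜]
  have h₁ := mt (key 1 (Or.inl rfl) 𝒜 hmem) hcon
  have h₂ := mt (key (-1) (Or.inr rfl) 𝒜ᶜ fun X => by
    rw [mem_compl, hmem]
    rcases neg_one_pow_eq_or ℝ #X with h | h <;> rw [h] <;> split_ifs <;> norm_num) hcon
  have hcard : #𝒜 + #𝒜ᶜ = 2 ^ Fintype.card β := by
    rw [card_add_card_compl, Fintype.card_finset]
  have heq : 2 * (#𝒜 : ℝ) = 2 ^ Fintype.card β := by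
    exact_mod_cast (by omega : 2 * #𝒜 = 2 ^ Fintype.card β)
  have hterm (X : Finset β) : (-1 : ℝ) ^ #X * (if F X then 1 else 0) =
      (if X ∈ 𝒜 then 1 else 0) - (1 - (-1) ^ #X) / 2 := by
    simp only [hmem]
    rcases neg_one_pow_eq_or ℝ #X with h | h <;> rw [h] <;> cases F X <;> norm_num
  have hpar : ∑ X : Finset β, (-1 : ℝ) ^ #X = 0 := by
    have := sum_powerset_neg_one_pow_card_of_nonempty (x := (univ : Finset β))
      (card_pos.1 (by simpa using h₀))
    rw [powerset_univ] at this
    exact_mod_cast this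
  apply hF
  simp only [hterm]
  rw [sum_sub_distrib, ← sum_div, sum_sub_distrib, hpar, sum_boole, filter_univ_mem]
  simp only [sum_const, card_univ, Fintype.card_finset, nsmul_eq_mul]
  push_cast
  linarith

end Hypercube

end BooleanFunction

namespace BooleanFunction

open Finset symmDiff Polynomial

/-! ### Multilinear coefficients and the degree bound -/

section Moebius

variable {α : Type*} [DecidableEq α]

/-- Expand a product over `A` whose factors are x on `M` and x + y elsewhere. It serves both Möbius
inversion (x + y = 0) and the binomial weights (x + y = 1). -/
lemma sum_powerset_superset_pow_mul_pow {R : Type*} [CommRing R] (x y : R) {M A : Finset α}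
    (hMA : M ⊆ A) :
    ∑ B ∈ A.powerset, (if M ⊆ B then x ^ #B * y ^ #(A \ B) else 0) =
      x ^ #M * (x + y) ^ #(A \ M) := by
  have h := prod_add (fun _ => x) (fun i => if i ∈ M then 0 else y) A
  have hl : ∏ i ∈ A, (x + if i ∈ M then 0 else y) = x ^ #M * (x + y) ^ #(A \ M) := by
    rw [← prod_sdiff hMA, mul_comm]
    congr 1
    · rw [prod_congr rfl fun i hi => by rw [if_pos hi, add_zero], prod_const]
    · rw [prod_congr rfl fun i hi => by rw [if_neg (mem_sdiff.1 hi).2], prod_const]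
  rw [← hl, h]
  refine sum_congr rfl fun B _ => ?_
  rw [prod_const]
  split_ifs with hMB
  · congr 1
    rw [prod_congr rfl fun i hi => by rw [if_neg fun h => (mem_sdiff.1 hi).2 (hMB h)], prod_const]
  · obtain ⟨i, hiM, hiB⟩ := not_subset.1 hMB
    rw [prod_eq_zero (i := i) (mem_sdiff.2 ⟨hMA hiM, hiB⟩) (by simp [hiM]), mul_zero]

/-- The coefficient of the monomial `∏ i ∈ S, x i` in the multilinear representation of `F`. -/
def coefficient (F : Finset α → Bool) (S : Finset α) : ℝ :=
  (-1) ^ #S * ∑ B ∈ S.powerset, (-1 : ℝ) ^ #B * (if F B then 1 else 0)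

lemma sum_coefficient (F : Finset α → Bool) (A : Finset α) :
    ∑ S ∈ A.powerset, coefficient F S = if F A then 1 else 0 := by
  have hinner (B : Finset α) (hB : B ∈ A.powerset) :
      ∑ S ∈ A.powerset, (if B ⊆ S then (-1 : ℝ) ^ #S else 0) =
        if B = A then (-1) ^ #A else 0 := by
    have := sum_powerset_superset_pow_mul_pow (-1 : ℝ) 1 (mem_powerset.1 hB)
    simp only [one_pow, mul_one, neg_add_cancel] at this
    rw [this]
    split_ifs with h
    · simp [h]
    · rw [zero_pow, mul_zero]
      rw [Ne, card_eq_zero, sdiff_eq_empty_iff_subset]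
      exact fun h' => h ((mem_powerset.1 hB).antisymm h')
  calc ∑ S ∈ A.powerset, coefficient F S
      = ∑ S ∈ A.powerset, ∑ B ∈ A.powerset,
          ((-1 : ℝ) ^ #B * (if F B then 1 else 0)) * (if B ⊆ S then (-1) ^ #S else 0) := by
        refine sum_congr rfl fun S hS => ?_
        rw [coefficient, mul_sum, ← sum_subset (powerset_mono.2 (mem_powerset.1 hS))]
        · refine sum_congr rfl fun B hB => ?_
          rw [if_pos (mem_powerset.1 hB), mul_comm]
        · intro B _ hB
          rw [if_neg fun h => hB (mem_powerset.2 h), mul_zero]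
    _ = ∑ B ∈ A.powerset, ((-1 : ℝ) ^ #B * (if F B then 1 else 0)) *
          if B = A then (-1) ^ #A else 0 := by
        rw [sum_comm]
        refine sum_congr rfl fun B hB => ?_
        rw [← mul_sum, hinner B hB]
    _ = if F A then 1 else 0 := by
        simp only [mul_ite, mul_zero, sum_ite_eq', mem_powerset_self, if_true]
        split_ifs <;> simp [← mul_pow]

end Moebius

/-- The degree of a Boolean function is at most the square of its sensitivity. -/
theorem card_le_sq_of_coefficient_ne_zero {α : Type*} [LinearOrder α] [Fintype α]
    (F : Finset α → Bool) {s : ℕ} (hs : ∀ X, #{i | F X ≠ F (X ∆ {i})} ≤ s) {S : Finset α}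
    (hS : coefficient F S ≠ 0) : #S ≤ s ^ 2 := by
  set e : S ↪ α := Function.Embedding.subtype (· ∈ S) with he
  -- Up to sign, the coefficient is the parity correlation of `F` on the subcube of subsets of `S`;
  -- restriction cannot raise sensitivity.
  have hsum : ∑ B : Finset S, (-1 : ℝ) ^ #B * (if F (B.map e) then 1 else 0) ≠ 0 := by
    intro h
    have hmap : (univ : Finset (Finset S)).map (mapEmbedding e).toEmbedding = S.powerset := by
      ext B
      simp only [mem_map, mem_univ, true_and, RelEmbedding.coe_toEmbedding, mapEmbedding_apply,
        mem_powerset]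
      constructor
      · rintro ⟨B', rfl⟩ i hi
        obtain ⟨j, -, rfl⟩ := mem_map.1 hi
        exact j.2
      · intro hB
        exact ⟨B.subtype (· ∈ S), subtype_map_of_mem hB⟩
    rw [coefficient, ← hmap, sum_map] at hS
    simp only [RelEmbedding.coe_toEmbedding, mapEmbedding_apply, card_map] at hS
    exact hS (mul_eq_zero_of_right _ h)
  obtain ⟨X, hX⟩ := exists_card_le_sensitivity_sq (fun B : Finset S => F (B.map e)) hsum
  rw [Fintype.card_coe] at hX
  refine hX.trans (Nat.pow_le_pow_left (le_trans ?_ (hs (X.map e))) 2)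
  rw [← card_map e]
  refine card_le_card fun i hi => ?_
  obtain ⟨j, hj, rfl⟩ := mem_map.1 hi
  simp only [mem_filter, mem_univ, true_and] at hj ⊢
  have hflip : X.map e ∆ {e j} = (X ∆ {j}).map e := by
    simp only [symmDiff_def, sup_eq_union, map_union, Finset.map_sdiff, map_singleton]
  rwa [hflip]

/-! ### The block polynomial -/

section Blocks

variable {α : Type*} [DecidableEq α] {𝓡 : Finset (Finset α)}

/-- The blocks of `𝓡` that meet `S`. -/
def blocksMeeting (𝓡 : Finset (Finset α)) (S : Finset α) : Finset (Finset α) :=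
  {R ∈ 𝓡 | ¬Disjoint R S}

lemma card_blocksMeeting_le (h𝓡 : ∀ R ∈ 𝓡, ∀ R' ∈ 𝓡, R ≠ R' → Disjoint R R') (S : Finset α) :
    #(blocksMeeting 𝓡 S) ≤ #S := by
  calc #(blocksMeeting 𝓡 S) = ∑ R ∈ blocksMeeting 𝓡 S, 1 := by simp
    _ ≤ ∑ R ∈ blocksMeeting 𝓡 S, #(R ∩ S) := by
        refine sum_le_sum fun R hR => ?_
        rw [Nat.one_le_iff_ne_zero, Ne, card_eq_zero, ← disjoint_iff_inter_eq_empty]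
        exact (mem_filter.1 hR).2
    _ = #((blocksMeeting 𝓡 S).biUnion (· ∩ S)) := by
        rw [card_biUnion]
        intro R hR R' hR' hne
        exact (h𝓡 R (mem_filter.1 hR).1 R' (mem_filter.1 hR').1 hne).mono
          inter_subset_left inter_subset_left
    _ ≤ #S := card_le_card (biUnion_subset.2 fun _ _ => inter_subset_right)

lemma subset_biUnion_iff (h𝓡 : ∀ R ∈ 𝓡, ∀ R' ∈ 𝓡, R ≠ R' → Disjoint R R')
    {B : Finset (Finset α)} (hB : B ⊆ 𝓡) {S : Finset α} (hS : S ⊆ 𝓡.biUnion id) :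
    S ⊆ B.biUnion id ↔ blocksMeeting 𝓡 S ⊆ B := by
  constructor
  · intro h R hR
    obtain ⟨hR𝓡, hRS⟩ := mem_filter.1 hR
    obtain ⟨i, hiR, hiS⟩ := not_disjoint_iff.1 hRS
    obtain ⟨R', hR', hi⟩ := mem_biUnion.1 (h hiS)
    by_cases hRR' : R = R'
    · exact hRR' ▸ hR'
    · exact absurd hi (disjoint_left.1 (h𝓡 R hR𝓡 R' (hB hR') hRR') hiR)
  · intro h i hi
    obtain ⟨R, hR, hiR⟩ := mem_biUnion.1 (hS hi)
    exact mem_biUnion.2 ⟨R, h (mem_filter.2 ⟨hR, not_disjoint_iff.2 ⟨i, hiR, hi⟩⟩), hiR⟩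

/-- The expected value of `F` when each block of `𝓡` is flipped independently with probability
`X`, as a polynomial in `X`. -/
noncomputable def blockPolynomial (F : Finset α → Bool) (𝓡 : Finset (Finset α)) : ℝ[X] :=
  ∑ B ∈ 𝓡.powerset, (if F (B.biUnion id) then 1 else 0) * (X ^ #B * (1 - X) ^ #(𝓡 \ B))

/-- The monomial of `S` equals 1 exactly when all blocks meeting `S` are flipped, an event of
probability X^k for k such blocks. -/
lemma blockPolynomial_eq_sum_coefficient (F : Finset α → Bool)
    (h𝓡 : ∀ R ∈ 𝓡, ∀ R' ∈ 𝓡, R ≠ R' → Disjoint R R') :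
    blockPolynomial F 𝓡 =
      ∑ S ∈ (𝓡.biUnion id).powerset, C (coefficient F S) * X ^ #(blocksMeeting 𝓡 S) := by
  have hF (B : Finset (Finset α)) (hB : B ∈ 𝓡.powerset) :
      (if F (B.biUnion id) then 1 else 0 : ℝ[X]) =
        ∑ S ∈ (𝓡.biUnion id).powerset,
          if blocksMeeting 𝓡 S ⊆ B then C (coefficient F S) else 0 := by
    rw [mem_powerset] at hB
    have h := congrArg (C : ℝ → ℝ[X]) (sum_coefficient F (B.biUnion id))
    rw [map_sum, apply_ite C, map_one, map_zero] at h
    rw [← h, ← sum_filter]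
    refine sum_congr ?_ fun _ _ => rfl
    ext S
    rw [mem_filter, mem_powerset, mem_powerset]
    constructor
    · intro hS
      have hS' := hS.trans (biUnion_subset_biUnion_of_subset_left id hB)
      exact ⟨hS', (subset_biUnion_iff h𝓡 hB hS').1 hS⟩
    · exact fun hS => (subset_biUnion_iff h𝓡 hB hS.1).2 hS.2
  calc blockPolynomial F 𝓡
      = ∑ B ∈ 𝓡.powerset, ∑ S ∈ (𝓡.biUnion id).powerset, C (coefficient F S) *
          (if blocksMeeting 𝓡 S ⊆ B then X ^ #B * (1 - X) ^ #(𝓡 \ B) else 0) := by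
        refine sum_congr rfl fun B hB => ?_
        rw [hF B hB, sum_mul]
        refine sum_congr rfl fun S _ => ?_
        split_ifs <;> simp
    _ = _ := by
        rw [sum_comm]
        refine sum_congr rfl fun S _ => ?_
        have hM : blocksMeeting 𝓡 S ⊆ 𝓡 := filter_subset _ _
        rw [← mul_sum, sum_powerset_superset_pow_mul_pow _ _ hM]
        simp

lemma degree_blockPolynomial_le (F : Finset α → Bool)
    (h𝓡 : ∀ R ∈ 𝓡, ∀ R' ∈ 𝓡, R ≠ R' → Disjoint R R') {D : ℕ}
    (hD : ∀ S, coefficient F S ≠ 0 → #S ≤ D) : (blockPolynomial F 𝓡).degree ≤ D := by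
  rw [blockPolynomial_eq_sum_coefficient F h𝓡]
  refine (degree_sum_le _ _).trans (Finset.sup_le fun S _ => ?_)
  by_cases hS : coefficient F S = 0
  · simp [hS]
  · refine (degree_C_mul_X_pow_le _ _).trans ?_
    exact_mod_cast (card_blocksMeeting_le h𝓡 S).trans (hD S hS)

lemma eval_blockPolynomial_mem_Icc (F : Finset α → Bool) {x : ℝ} (hx : x ∈ Set.Icc (0 : ℝ) 1) :
    (blockPolynomial F 𝓡).eval x ∈ Set.Icc (0 : ℝ) 1 := by
  have hx₁ : 0 ≤ 1 - x := sub_nonneg.2 hx.2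
  have hx₀ := hx.1
  have heval : (blockPolynomial F 𝓡).eval x =
      ∑ B ∈ 𝓡.powerset, (if F (B.biUnion id) then 1 else 0) * (x ^ #B * (1 - x) ^ #(𝓡 \ B)) := by
    rw [blockPolynomial, eval_finsetSum]
    refine sum_congr rfl fun B _ => ?_
    split_ifs <;> simp
  have htot := sum_powerset_superset_pow_mul_pow x (1 - x) (empty_subset 𝓡)
  simp only [empty_subset, if_true, card_empty, pow_zero, add_sub_cancel, one_pow, mul_one]
    at htot
  rw [heval]
  constructor
  · refine sum_nonneg fun B _ => mul_nonneg ?_ (by positivity)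
    split_ifs <;> simp
  · refine (sum_le_sum fun B _ => mul_le_of_le_one_left (by positivity) ?_).trans_eq htot
    split_ifs <;> simp

/-- Each of the b single blocks contributes -(b - 1), each pair at most 1, and larger families
nothing. -/
lemma coeff_two_blockPolynomial_le {F : Finset α → Bool} (h₀ : F ∅ = false)
    (h₁ : ∀ R ∈ 𝓡, F R = true) :
    (blockPolynomial F 𝓡).coeff 2 ≤ -((#𝓡 : ℝ) * (#𝓡 - 1) / 2) := by
  set b := #𝓡 with hb
  have hterm (B : Finset (Finset α)) (hB : B ∈ 𝓡.powerset) :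
      (((if F (B.biUnion id) then 1 else 0 : ℝ[X])) *
        (X ^ #B * (1 - X) ^ #(𝓡 \ B))).coeff 2 ≤
      if #B = 1 then -((b : ℝ) - 1) else if #B = 2 then 1 else 0 := by
    rw [mem_powerset] at hB
    have hcoeff : (X ^ #B * (1 - X) ^ #(𝓡 \ B) : ℝ[X]).coeff 2 =
        if #B ≤ 2 then ((1 - X : ℝ[X]) ^ #(𝓡 \ B)).coeff (2 - #B) else 0 := by
      rw [coeff_X_pow_mul']
    have hone (m : ℕ) : ((1 - X : ℝ[X]) ^ m).coeff 0 = 1 := by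
      simp [coeff_zero_eq_eval_zero]
    have hlin (m : ℕ) : ((1 - X : ℝ[X]) ^ m).coeff 1 = -m := by
      induction m with
      | zero => simp [coeff_one]
      | succ m ih =>
        rw [pow_succ, mul_sub, mul_one, coeff_sub, ih, coeff_mul_X, hone]
        push_cast
        ring
    rcases lt_trichotomy #B 1 with h | h | h
    · have : B = ∅ := card_eq_zero.1 (by omega)
      subst this
      simp [h₀]
    · obtain ⟨R, rfl⟩ := card_eq_one.1 h
      have hR : R ∈ 𝓡 := hB (mem_singleton_self R)
      have hcard : ((#(𝓡 \ {R}) : ℕ) : ℝ) = b - 1 := by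
        rw [cast_card_sdiff hB]
        simp [hb]
      rw [singleton_biUnion, id, h₁ R hR, if_pos rfl, one_mul, hcoeff]
      simp [hlin, hcard]
    · rw [if_neg h.ne']
      by_cases hF : F (B.biUnion id) = true
      · rw [if_pos hF, one_mul, hcoeff]
        split_ifs with h₂ h₃ h₃
        · rw [h₃, hone]
        · omega
        · omega
        · rfl
      · rw [if_neg hF, zero_mul, coeff_zero]
        split_ifs <;> norm_num
  rw [blockPolynomial, finsetSum_coeff]
  refine (sum_le_sum hterm).trans (le_of_eq ?_)
  rw [sum_powerset_apply_card (fun k => if k = 1 then -((b : ℝ) - 1) else if k = 2 then 1 else 0)]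
  rw [← hb]
  have hsplit (k : ℕ) : b.choose k • (if k = 1 then -((b : ℝ) - 1) else if k = 2 then 1 else 0) =
      (if k = 1 then -((b : ℝ) - 1) * b else 0) + if k = 2 then (b.choose 2 : ℝ) else 0 := by
    split_ifs with h h' h'
    · omega
    · subst h
      simp [mul_comm]
    · subst h'
      simp
    · simp
  simp only [hsplit, sum_add_distrib, sum_ite_eq', mem_range]
  rw [Nat.cast_choose_two]
  rcases Nat.lt_or_ge b 2 with h | h
  · interval_cases b <;> norm_num
  · rw [if_pos (by omega), if_pos (by omega)]
    ring

end Blocks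

/-- A bound of V. A. Markov type for the second derivative at an endpoint of `[0, 1]`. -/
lemma neg_coeff_two_le {p : ℝ[X]} {D : ℕ} (hdeg : p.degree ≤ D)
    (hp : ∀ x ∈ Set.Icc (0 : ℝ) 1, p.eval x ∈ Set.Icc (0 : ℝ) 1) :
    -p.coeff 2 ≤ (D : ℝ) ^ 2 * (D ^ 2 - 1) / 3 := by
  -- This substitution takes [-1, 1] to [0, 1] and 1 to 0. Then q = 1 - 2 p∘ℓ is bounded by 1 in
  -- absolute value and q''(1) = -p''(0)/2.
  set ℓ : ℝ[X] := C (1 / 2) * (1 - X) with hℓ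
  have hℓ' : derivative ℓ = C (-1 / 2) := by
    rw [hℓ, derivative_C_mul]
    simp only [derivative_sub, derivative_one, derivative_X, zero_sub, mul_neg, mul_one, ← C_neg]
    norm_num
  set q : ℝ[X] := 1 - C 2 * p.comp ℓ with hq
  have hqdeg : q.degree ≤ D := by
    have h : (p.comp ℓ).natDegree ≤ D := by
      refine natDegree_comp_le.trans ?_
      have h₁ : ℓ.natDegree ≤ 1 := by rw [hℓ]; compute_degree
      have h₂ := natDegree_le_of_degree_le hdeg
      nlinarith
    refine (degree_sub_le _ _).trans (max_le ?_ ?_)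
    · exact degree_one_le.trans (by exact_mod_cast Nat.zero_le D)
    · exact degree_le_of_natDegree_le ((natDegree_C_mul_le _ _).trans h)
  have hqbnd : ∀ x ∈ Set.Icc (-1 : ℝ) 1, |q.eval x| ≤ 1 := by
    intro x hx
    have h := hp (1 / 2 * (1 - x)) ⟨by linarith [hx.2], by linarith [hx.1]⟩
    have he : q.eval x = 1 - 2 * p.eval (1 / 2 * (1 - x)) := by
      simp [hq, hℓ, eval_comp]
    rw [he, abs_le]
    constructor <;> linarith [h.1, h.2]
  have hq₂ : (derivative^[2] q).eval 1 = -p.coeff 2 := by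
    have h₁ : derivative q = (derivative p).comp ℓ := by
      rw [hq, derivative_sub, derivative_one, derivative_C_mul, derivative_comp, hℓ', ← mul_assoc,
        ← C_mul, zero_sub, ← neg_mul, ← C_neg]
      norm_num
    have h : derivative^[2] q = C (-1 / 2) * (derivative (derivative p)).comp ℓ := by
      rw [Function.iterate_succ_apply, Function.iterate_one, h₁, derivative_comp, hℓ']
    rw [h, eval_mul, eval_C, eval_comp]
    have hz : ℓ.eval 1 = 0 := by simp [hℓ]
    rw [hz, ← coeff_zero_eq_eval_zero, coeff_derivative, coeff_derivative]
    norm_num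
    ring
  -- The extremal value is T_D''(1) = D²(D² - 1)/3.
  have hT := Chebyshev.eval_iterate_derivative_le_of_forall_abs_le_one (k := 2) le_rfl hqdeg hqbnd
  rw [hq₂, Chebyshev.iterate_derivative_T_eval_one_eq_div] at hT
  simpa [prod_range_succ] using hT

end BooleanFunction

/-! ### Back to Boolean functions: the quadratic inequality and low sensitivity -/

namespace BooleanFunction

open Finset symmDiff

variable {n : ℕ}

lemma flipBlock_flipBlock (x : Fin n → Bool) (A B : Finset (Fin n)) :
    flipBlock (flipBlock x A) B = flipBlock x (A ∆ B) := by
  ext i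
  by_cases hA : i ∈ A <;> by_cases hB : i ∈ B <;> simp [flipBlock, mem_symmDiff, hA, hB]

lemma flipBlock_empty (x : Fin n → Bool) : flipBlock x ∅ = x := by
  ext i
  simp [flipBlock]

lemma exists_flipBlock_eq (x y : Fin n → Bool) : ∃ A, flipBlock x A = y := by
  refine ⟨univ.filter fun i => x i ≠ y i, ?_⟩
  ext i
  cases hx : x i <;> cases hy : y i <;> simp [flipBlock, hx, hy]

/-- Whether flipping the block `A` changes the value of `f` at `x`. -/
def changeAt (f : (Fin n → Bool) → Bool) (x : Fin n → Bool) (A : Finset (Fin n)) : Bool :=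
  f x != f (flipBlock x A)

lemma changeAt_empty (f : (Fin n → Bool) → Bool) (x : Fin n → Bool) : changeAt f x ∅ = false := by
  simp [changeAt, flipBlock_empty]

lemma card_changeAt_ne_le_sensitivity (f : (Fin n → Bool) → Bool) (x : Fin n → Bool)
    (A : Finset (Fin n)) :
    #{i | changeAt f x A ≠ changeAt f x (A ∆ {i})} ≤ sensitivity f := by
  refine le_trans (card_le_card fun i hi => ?_)
    (le_sup (f := localSensitivity f) (mem_univ (flipBlock x A)))
  refine mem_filter.2 ⟨mem_univ _, fun h => (mem_filter.1 hi).2 ?_⟩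
  rw [changeAt, changeAt, h, flipBlock_flipBlock]

lemma exists_card_eq_blockSensitivity (f : (Fin n → Bool) → Bool) :
    ∃ x 𝓡, IsSensitiveFamily f x 𝓡 ∧ #𝓡 = blockSensitivity f := by
  obtain ⟨x, -, hx⟩ := exists_mem_eq_sup univ univ_nonempty (localBlockSensitivity f)
  have hne : (univ.filter fun 𝓡 : Finset (Finset (Fin n)) => IsSensitiveFamily f x 𝓡).Nonempty :=
    ⟨∅, mem_filter.2 ⟨mem_univ _, by simp [IsSensitiveFamily]⟩⟩
  obtain ⟨𝓡, h𝓡, hcard⟩ := exists_mem_eq_sup _ hne Finset.card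
  exact ⟨x, 𝓡, (mem_filter.1 h𝓡).2, by rw [blockSensitivity, hx, localBlockSensitivity, hcard]⟩

/-- A bound for the block sensitivity in terms of the sensitivity, from the second derivative of
the block polynomial. -/
theorem blockSensitivity_mul_sub_one_le (f : (Fin n → Bool) → Bool) :
    (blockSensitivity f : ℝ) * (blockSensitivity f - 1) / 2 ≤
      (sensitivity f : ℝ) ^ 4 * ((sensitivity f : ℝ) ^ 4 - 1) / 3 := by
  obtain ⟨x, 𝓡, ⟨hdisj, hsens⟩, hcard⟩ := exists_card_eq_blockSensitivity f
  have hdeg := degree_blockPolynomial_le (changeAt f x) hdisj fun S hS =>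
    card_le_sq_of_coefficient_ne_zero _ (card_changeAt_ne_le_sensitivity f x) hS
  have h₁ := neg_coeff_two_le hdeg fun t ht => eval_blockPolynomial_mem_Icc _ ht
  have h₂ := coeff_two_blockPolynomial_le (𝓡 := 𝓡) (changeAt_empty f x) fun R hR => by
    simpa [changeAt] using hsens R hR
  rw [hcard] at h₂
  push_cast at h₁
  rw [← pow_mul] at h₁
  linarith

/-- A non-constant function of sensitivity at most one is a literal. -/
theorem isLiteral_of_sensitivity_le_one {f : (Fin n → Bool) → Bool} (hs : sensitivity f ≤ 1)
    {x y : Fin n → Bool} (hxy : f x ≠ f y) : IsLiteral f := by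
  set F := changeAt f x with hF
  have hF₀ : F ∅ = false := changeAt_empty f x
  have hc (S : Finset (Fin n)) (hS : 1 < #S) : coefficient F S = 0 := by
    by_contra h
    have := card_le_sq_of_coefficient_ne_zero F
      (fun X => (card_changeAt_ne_le_sensitivity f x X).trans hs) h
    omega
  have hc₀ : coefficient F ∅ = 0 := by simp [coefficient, hF₀]
  -- The degree is at most 1, so `F` is additive over points. Being 0/1-valued, it has at most one
  -- nonzero coefficient.
  have hsum (A : Finset (Fin n)) :
      ∑ i ∈ A, coefficient F {i} = if F A then 1 else 0 := by
    rw [← sum_coefficient F A, ← sum_subset (s₁ := A.map ⟨singleton, singleton_injective⟩)]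
    · simp
    · intro S hS
      obtain ⟨i, hi, rfl⟩ := mem_map.1 hS
      simpa using hi
    · intro S hS hS'
      rcases lt_trichotomy #S 1 with h | h | h
      · rw [card_eq_zero.1 (by omega : #S = 0), hc₀]
      · obtain ⟨i, rfl⟩ := card_eq_one.1 h
        exact absurd (mem_map.2 ⟨i, singleton_subset_iff.1 (mem_powerset.1 hS), rfl⟩) hS'
      · exact hc S h
  have hval (i : Fin n) : coefficient F {i} = if F {i} then 1 else 0 := by
    rw [← hsum, sum_singleton]
  obtain ⟨B, rfl⟩ := exists_flipBlock_eq x y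
  have hFB : F B = true := by simpa [hF, changeAt] using hxy
  obtain ⟨i, -, hi⟩ : ∃ i ∈ B, coefficient F {i} ≠ 0 := by
    apply exists_ne_zero_of_sum_ne_zero
    rw [hsum, hFB]
    simp
  have hi₁ : coefficient F {i} = 1 := by
    rw [hval] at hi ⊢
    split_ifs at hi ⊢
    · rfl
    · exact absurd rfl hi
  have hzero (j : Fin n) (hj : j ≠ i) : coefficient F {j} = 0 := by
    have h := hsum {i, j}
    rw [sum_pair hj.symm, hi₁, hval] at h
    rw [hval]
    split_ifs at h ⊢ <;> first | rfl | norm_num at h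
  have hFA (A : Finset (Fin n)) : F A = true ↔ i ∈ A := by
    have h := hsum A
    rw [sum_congr rfl (g := fun j => if j = i then (1 : ℝ) else 0), sum_ite_eq'] at h
    · by_cases hA : i ∈ A <;> cases hFA : F A <;> simp_all
    · intro j _
      split_ifs with hj
      · rw [hj, hi₁]
      · exact hzero j hj
  refine ⟨i, ?_⟩
  have hf (z : Fin n → Bool) : f z = ((f x != x i) != z i) := by
    obtain ⟨A, rfl⟩ := exists_flipBlock_eq x z
    have h := hFA A
    by_cases hA : i ∈ A <;> simp only [hA, iff_true, iff_false, hF, changeAt] at h <;>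
      simp only [flipBlock, hA, if_true, if_false] <;> revert h <;>
      generalize f (flipBlock x A) = u <;> generalize f x = v <;> generalize x i = w <;>
      revert u v w <;> decide
  cases h : f x != x i
  · exact Or.inl fun z => by rw [hf, h, Bool.false_bne]
  · exact Or.inr fun z => by rw [hf, h, Bool.true_bne]

end BooleanFunction

theorem mainTheorem3 {n : ℕ} (f : (Fin n → Bool) → Bool)
    (hf : ¬ BooleanFunction.IsLiteral f) :
    (BooleanFunction.sensitivity f : ℝ) ^ 4 ≥
      (Real.sqrt 10 - 2) * (BooleanFunction.blockSensitivity f : ℝ) := by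
  have hmain := BooleanFunction.blockSensitivity_mul_sub_one_le f
  by_cases hs : BooleanFunction.sensitivity f ≤ 1
  · have hb : BooleanFunction.blockSensitivity f = 0 := by
      obtain ⟨x, 𝓡, h𝓡, hcard⟩ := BooleanFunction.exists_card_eq_blockSensitivity f
      rw [← hcard, Finset.card_eq_zero, Finset.eq_empty_iff_forall_notMem]
      exact fun R hR => hf (BooleanFunction.isLiteral_of_sensitivity_le_one hs (h𝓡.2 R hR))
    simp [hb]
  · set b : ℝ := (BooleanFunction.blockSensitivity f : ℝ)
    set N : ℝ := (BooleanFunction.sensitivity f : ℝ) ^ 4 with hN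
    have hN₁₆ : 16 ≤ N := by
      have h₂ : (2 : ℝ) ≤ BooleanFunction.sensitivity f := by exact_mod_cast not_le.1 hs
      calc (16 : ℝ) = 2 ^ 4 := by norm_num
        _ ≤ N := pow_le_pow_left₀ (by norm_num) h₂ 4
    by_contra! hlt
    -- There is slack: asymptotically any κ with κ² < 3/2 would do, and here κ² ≈ 1.35.
    set κ : ℝ := √10 - 2 with hκ
    have hκ₂ : κ ^ 2 = 6 - 4 * κ := by
      have := Real.sq_sqrt (show (0 : ℝ) ≤ 10 by norm_num)
      rw [hκ]
      linear_combination this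
    have hκ_lower : 1.16 < κ := by
      have : (3.16 : ℝ) < √10 := Real.lt_sqrt_of_sq_lt (by norm_num)
      linarith
    have hκ_upper : κ < 1.17 := by
      have : √10 < (3.17 : ℝ) := (Real.sqrt_lt' (by norm_num)).2 (by norm_num)
      linarith
    have hb : 10 < b := by nlinarith
    have hmono : N * (N - 1) ≤ κ * b * (κ * b - 1) := by nlinarith
    have hquad : κ * b * (κ * b - 1) = (6 - 4 * κ) * b ^ 2 - κ * b := by
      linear_combination b ^ 2 * hκ₂
    -- Six times `hmain`, combined with `hmono` and `hquad`, says that this product is at most 0.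
    have h₁ : 0 < b * ((8 * κ - 9) * b - (3 - 2 * κ)) := by
      apply mul_pos (by linarith)
      nlinarith
    nlinarith
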